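/- Let $\mathcal A$ be a finitely generated commutative unital $\mathbb R$-algebra. A *semiring* of $\mathcal A$ is a nonempty subset $\mathcal S\subseteq\mathcal A$ with $1\in\mathcal S$, $\mathcal S+\mathcal S\subseteq\mathcal S$, $\mathcal S\cdot\mathcal S\subseteq\mathcal S$ and $\lambda\mathcal S\subseteq\mathcal S$ for all real $\lambda\ge 0$; it is *Archimedean* if for every $a\in\mathcal A$ there is a real $\lambda>0$ with $\lambda 1-a\in\mathcal S$ and $\lambda 1+a\in\mathcal S$. Let $\mathcal S$ be an Archimedean semiring of $\mathcal A$ and let $J$ be an unbounded closed subset of $\mathbb R$. Let $\mathcal X(\mathcal A,\mathcal S)$ be the set of unital algebra homomorphisms $\varphi:\mathcal A\to\mathbb R$ with $\varphi(s)\ge 0$ for all $s\in\mathcal S$, let $\mathrm{Pos}(J)=\{p\in\mathbb R[z]: p(t)\ge 0 \text{ for all } t\in J\}$, and let $\mathcal S\otimes\mathrm{Pos}(J)\subseteq\mathcal A[z]$ be the set of all finite sums of elements $s\,p$ with $s\in\mathcal S$ and $p\in\mathrm{Pos}(J)$. Each pair $(\varphi,\eta)\in\mathcal X(\mathcal A,\mathcal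 S)\times J$ is identified with the unital algebra homomorphism $\mathcal A[z]\to\mathbb R$, $a\mapsto\varphi(a(\eta))$, so that $\mathcal X(\mathcal A,\mathcal S)\times J$ is a subset of the space of all unital algebra homomorphisms $\mathcal A[z]\to\mathbb R$, which carries the topology of pointwise convergence on $\mathcal A[z]$. Let $L:\mathcal A[z]\to\mathbb R$ be a linear functional with $L(a)\ge 0$ for all $a\in\mathcal S\otimes\mathrm{Pos}(J)$. Then $L$ is an $(\mathcal X(\mathcal A,\mathcal S)\times J)$-moment functional: there is a (nonnegative) Radon measure $\mu$ supported on $\mathcal X(\mathcal A,\mathcal S)\times J$ such that, for every $a\in\mathcal A[z]$, the function $(\varphi,\eta)\mapsto\varphi(a(\eta))$ is $\mu$-integrable and $$L(a)=\int_{\mathcal X(\mathcal A,\mathcal S)\times J}\varphi(a(\eta))\,d\mu(\varphi,\eta).$$ -/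

import Mathlib

namespace CylinderMoment

open MeasureTheory

/-- A convex cone in a real algebra: a nonempty subset closed under addition and under
multiplication by nonnegative real scalars. -/
structure IsConvexCone {A : Type*} [CommRing A] [Algebra ℝ A] (C : Set A) : Prop where
  nonempty : C.Nonempty
  add_mem : ∀ a ∈ C, ∀ b ∈ C, a + b ∈ C
  smul_mem : ∀ r : ℝ, 0 ≤ r → ∀ a ∈ C, r • a ∈ C

/-- A semiring (preprime) of a commutative unital real algebra: a convex cone that contains the
unit and is closed under multiplication. -/
structure IsSemiring {A : Type*} [CommRing A] [Algebra ℝ A] (S : Set A) : Prop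
    extends IsConvexCone S where
  one_mem : (1 : A) ∈ S
  mul_mem : ∀ a ∈ S, ∀ b ∈ S, a * b ∈ S

/-- The set of elements of `A` that are bounded with respect to `C`. -/
def boundedElements {A : Type*} [CommRing A] [Algebra ℝ A] (C : Set A) : Set A :=
  {a | ∃ r : ℝ, 0 < r ∧ algebraMap ℝ A r - a ∈ C ∧ algebraMap ℝ A r + a ∈ C}

/-- The cone `C` is Archimedean if every element of `A` is bounded with respect to `C`. -/
def IsArchimedean {A : Type*} [CommRing A] [Algebra ℝ A] (C : Set A) : Prop :=
  boundedElements C = Set.univ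

/-- The characters of a commutative unital real algebra: unital algebra homomorphisms to `ℝ`. -/
abbrev Character (A : Type*) [CommRing A] [Algebra ℝ A] : Type _ := A →ₐ[ℝ] ℝ

/-- The weak topology on the characters: the coarsest topology that makes all evaluations
`φ ↦ φ a` continuous. -/
instance Character.topologicalSpace (A : Type*) [CommRing A] [Algebra ℝ A] :
    TopologicalSpace (Character A) :=
  TopologicalSpace.induced (fun (φ : Character A) (a : A) => φ a) inferInstance

/-- The characters carry the Borel σ-algebra of the weak topology. -/
instance Character.measurableSpace (A : Type*) [CommRing A] [Algebra ℝ A] :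
    MeasurableSpace (Character A) :=
  borel (Character A)

instance Character.borelSpace (A : Type*) [CommRing A] [Algebra ℝ A] :
    BorelSpace (Character A) :=
  ⟨rfl⟩

/-- The `C`-positive characters: those that are nonnegative on `C`. -/
def positiveCharacters {A : Type*} [CommRing A] [Algebra ℝ A] (C : Set A) : Set (Character A) :=
  {φ | ∀ a ∈ C, 0 ≤ φ a}

/-- The real polynomials in one variable that are nonnegative at every point of `J`. -/
def posPolynomials (J : Set ℝ) : Set (Polynomial ℝ) :=
  {p | ∀ t ∈ J, 0 ≤ p.eval t}

/-- For subsets `S` of `A` and `P` of `ℝ[z]`, the set `S ⊗ P` of all finite sums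
`∑ sᵢ pᵢ` in `A[z] ≅ A ⊗ ℝ[z]` with `sᵢ ∈ S` and `pᵢ ∈ P`. -/
def tensorCone {A : Type*} [CommRing A] [Algebra ℝ A] (S : Set A) (P : Set (Polynomial ℝ)) :
    Set (Polynomial A) :=
  {a | ∃ (n : ℕ) (s : Fin n → A) (p : Fin n → Polynomial ℝ),
    (∀ i, s i ∈ S) ∧ (∀ i, p i ∈ P) ∧
      a = ∑ i, Polynomial.C (s i) * (p i).map (algebraMap ℝ A)}

/-- The character `a ↦ φ (a(η))` of `A[z]` given by a character `φ` of `A` and a real `η`. -/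
noncomputable def pairCharacter {A : Type*} [CommRing A] [Algebra ℝ A]
    (φ : Character A) (η : ℝ) : Character (Polynomial A) :=
  φ.comp ((Polynomial.aeval (R := A) (algebraMap ℝ A η)).restrictScalars ℝ)

/-- The set `K × J`, for `K` a set of characters of `A` and `J ⊆ ℝ`, as a set of characters
of `A[z]`. -/
def cylinder {A : Type*} [CommRing A] [Algebra ℝ A] (K : Set (Character A)) (J : Set ℝ) :
    Set (Character (Polynomial A)) :=
  {χ | ∃ φ ∈ K, ∃ η ∈ J, χ = pairCharacter φ η}

/-- A Radon measure: a (nonnegative) Borel measure that is locally finite and inner regular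
with respect to compact sets. -/
structure IsRadonMeasure {X : Type*} [TopologicalSpace X] [MeasurableSpace X] [BorelSpace X]
    (μ : Measure X) : Prop where
  locallyFinite : IsLocallyFiniteMeasure μ
  innerRegular : μ.InnerRegular

/-- The linear functional `L` on `B` is a `K`-moment functional: there is a Radon measure `μ` on
the characters, supported on `K`, such that every element of `B` is integrable and
`L b = ∫_K χ(b) dμ(χ)` for all `b`. -/
def IsMomentFunctional {B : Type*} [CommRing B] [Algebra ℝ B] (K : Set (Character B))
    (L : B →ₗ[ℝ] ℝ) : Prop :=
  ∃ μ : Measure (Character B), IsRadonMeasure μ ∧ μ Kᶜ = 0 ∧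
    ∀ b : B, IntegrableOn (fun χ : Character B => χ b) K μ ∧ L b = ∫ χ in K, χ b ∂μ

end CylinderMoment

/-! By Haviland's theorem (`isMomentFunctional_of_nonneg`) it suffices that `L a ≥ 0` whenever `a`
is nonnegative on the closed set `𝒳(A, S) × J`; this is `nonneg_of_nonneg_on_cylinder`.

The Archimedean property makes `𝒳(A, S)` and the state space of `S` compact. Extreme states are
multiplicative, so by Krein–Milman a functional nonnegative on `S` is nonnegative on every element
that is nonnegative on `𝒳(A, S)`. Applied to `a ↦ L (a q)` with `q ∈ Pos(J)`, this replaces `S` by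
the larger cone of all such elements. A partition of unity on `𝒳(A, S)` then approximates `a` by `∑
eᵢ a(φᵢ)`, with `eᵢ ≥ 0` on `𝒳(A, S)` and `a(φᵢ) ∈ Pos(J)`. The error has bounded degree and
uniformly small coefficients, so `abs_C_mul_X_pow_le` makes its image under `L` small.

For Haviland's theorem, M. Riesz extension carries `L` over to compactly supported functions and
Riesz–Markov gives the measure. Cutoffs along a proper element `w`, which exists by finite
generation, recover `L` itself. -/

open MeasureTheory Filter Topology

namespace CylinderMoment

/-! ### Topology of the character space -/

section Topology

variable {A : Type*} [CommRing A] [Algebra ℝ A]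

theorem Character.isEmbedding_coe :
    IsEmbedding (fun (φ : Character A) (a : A) => φ a) :=
  ⟨⟨rfl⟩, fun _ _ h => AlgHom.ext fun a => congrFun h a⟩

theorem Character.continuous_eval (a : A) : Continuous fun φ : Character A => φ a :=
  (continuous_apply a).comp Character.isEmbedding_coe.continuous

instance Character.t2Space : T2Space (Character A) :=
  Character.isEmbedding_coe.t2Space

/-- Being a character is a system of closed conditions in the product `A → ℝ`, so Tychonoff's
theorem yields compactness from bounds on evaluations. -/
theorem Character.isClosedEmbedding_coe :
    IsClosedEmbedding (fun (φ : Character A) (a : A) => φ a) := by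
  refine ⟨Character.isEmbedding_coe, ?_⟩
  have : Set.range (fun (φ : Character A) (a : A) => φ a) =
      {f : A → ℝ | (∀ a b, f (a + b) = f a + f b) ∧ (∀ a b, f (a * b) = f a * f b) ∧
        ∀ r : ℝ, f (algebraMap ℝ A r) = r} := by
    ext f
    constructor
    · rintro ⟨φ, rfl⟩
      exact ⟨map_add φ, map_mul φ, fun r => φ.commutes r⟩
    · rintro ⟨hadd, hmul, hr⟩
      have h0 : f 0 = 0 := by simpa using hr 0
      have h1 : f 1 = 1 := by simpa using hr 1
      exact ⟨{ toFun := f, map_one' := h1, map_mul' := hmul, map_zero' := h0, map_add' := hadd,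
               commutes' := hr }, rfl⟩
  rw [this]
  simp only [Set.ofPred_and, Set.ofPred_forall]
  refine IsClosed.inter ?_ (IsClosed.inter ?_ ?_)
  · exact isClosed_iInter fun a => isClosed_iInter fun b =>
      isClosed_eq (by fun_prop) (by fun_prop)
  · exact isClosed_iInter fun a => isClosed_iInter fun b =>
      isClosed_eq (by fun_prop) (by fun_prop)
  · exact isClosed_iInter fun r => isClosed_eq (continuous_apply _) continuous_const

/-- A closed set of characters on which all evaluations are bounded is compact. -/
theorem Character.isCompact_of_isClosed_of_bounded {K : Set (Character A)} (hK : IsClosed K)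
    (hb : ∀ a : A, ∃ r : ℝ, ∀ φ ∈ K, |φ a| ≤ r) : IsCompact K := by
  choose r hr using hb
  have hc : IsCompact (Set.pi Set.univ fun a : A => Set.Icc (-r a) (r a)) :=
    isCompact_univ_pi fun a => isCompact_Icc
  exact (Character.isClosedEmbedding_coe.isCompact_preimage hc).of_isClosed_subset hK
    fun φ hφ a _ => abs_le.1 (hr a φ hφ)

end Topology

/-! ### States of an Archimedean semiring and Krein–Milman -/

section States

variable {A : Type*} [CommRing A] [Algebra ℝ A] {S : Set A}

theorem IsArchimedean.exists_bound (h : IsArchimedean S) (a : A) :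
    ∃ r : ℝ, 0 < r ∧ algebraMap ℝ A r - a ∈ S ∧ algebraMap ℝ A r + a ∈ S := by
  have : a ∈ boundedElements S := by rw [h]; trivial
  exact this

theorem isClosed_positiveCharacters (S : Set A) : IsClosed (positiveCharacters S) := by
  simp only [positiveCharacters, Set.ofPred_forall]
  exact isClosed_iInter fun a => isClosed_iInter fun _ =>
    isClosed_le continuous_const (Character.continuous_eval a)

theorem isCompact_positiveCharacters (h : IsArchimedean S) :
    IsCompact (positiveCharacters S) := by
  refine Character.isCompact_of_isClosed_of_bounded (isClosed_positiveCharacters S) fun a => ?_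
  obtain ⟨r, -, h1, h2⟩ := h.exists_bound a
  refine ⟨r, fun φ hφ => abs_le.2 ?_⟩
  have e1 := hφ _ h1
  have e2 := hφ _ h2
  simp only [map_sub, map_add, AlgHom.commutes, Algebra.algebraMap_self, RingHom.id_apply] at e1 e2
  constructor <;> linarith

/-- The normalized linear functionals that are nonnegative on `S`, as a set of functions. -/
def states (S : Set A) : Set (A → ℝ) :=
  {f | (∀ a b, f (a + b) = f a + f b) ∧ (∀ (r : ℝ) a, f (r • a) = r * f a) ∧
    (∀ s ∈ S, 0 ≤ f s) ∧ f 1 = 1}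

theorem states_map_sub {f : A → ℝ} (hf : f ∈ states S) (a b : A) : f (a - b) = f a - f b := by
  have := hf.1 (a - b) b
  rw [sub_add_cancel] at this
  linarith

theorem states_map_algebraMap {f : A → ℝ} (hf : f ∈ states S) (r : ℝ) :
    f (algebraMap ℝ A r) = r := by
  rw [Algebra.algebraMap_eq_smul_one, hf.2.1, hf.2.2.2, mul_one]

theorem convex_states (S : Set A) : Convex ℝ (states S) := by
  intro f hf g hg u v hu hv huv
  refine ⟨fun a b => ?_, fun r a => ?_, fun s hs => ?_, ?_⟩
  · simp only [Pi.add_apply, Pi.smul_apply, smul_eq_mul, hf.1, hg.1]; ring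
  · simp only [Pi.add_apply, Pi.smul_apply, smul_eq_mul, hf.2.1, hg.2.1]; ring
  · have := hf.2.2.1 s hs
    have := hg.2.2.1 s hs
    simp only [Pi.add_apply, Pi.smul_apply, smul_eq_mul]
    positivity
  · simp [hf.2.2.2, hg.2.2.2, huv]

theorem isCompact_states (h : IsArchimedean S) : IsCompact (states S) := by
  choose r _ h1 h2 using h.exists_bound
  have hc : IsCompact (Set.pi Set.univ fun a : A => Set.Icc (-r a) (r a)) :=
    isCompact_univ_pi fun a => isCompact_Icc
  refine hc.of_isClosed_subset ?_ fun f hf a _ => ?_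
  · simp only [states, Set.ofPred_and, Set.ofPred_forall]
    refine IsClosed.inter ?_ (IsClosed.inter ?_ (IsClosed.inter ?_ ?_))
    · exact isClosed_iInter fun a => isClosed_iInter fun b =>
        isClosed_eq (by fun_prop) (by fun_prop)
    · exact isClosed_iInter fun a => isClosed_iInter fun b =>
        isClosed_eq (continuous_apply _) (continuous_const.mul (continuous_apply _))
    · exact isClosed_iInter fun a => isClosed_iInter fun _ =>
        isClosed_le continuous_const (continuous_apply _)
    · exact isClosed_eq (continuous_apply _) continuous_const
  · have e1 := hf.2.2.1 _ (h1 a)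
    have e2 := hf.2.2.1 _ (h2 a)
    rw [states_map_sub hf, states_map_algebraMap hf] at e1
    rw [hf.1, states_map_algebraMap hf] at e2
    constructor <;> linarith

/-- Multiplying a state by an element of `S` and normalizing gives a state. -/
theorem states_mul_div (hS : IsSemiring S) {f : A → ℝ} (hf : f ∈ states S) {s : A} (hs : s ∈ S)
    (hpos : 0 < f s) : (fun a => f (s * a) / f s) ∈ states S := by
  refine ⟨fun a b => ?_, fun r a => ?_, fun t ht => ?_, ?_⟩
  · simp only [mul_add, hf.1, add_div]
  · simp only [mul_smul_comm, hf.2.1, mul_div_assoc]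
  · exact div_nonneg (hf.2.2.1 _ (hS.mul_mem s hs t ht)) hpos.le
  · simp [hpos.ne']

/-- For `s` and `r - s` in `S`, the state `f` is a convex combination of the normalizations of `f (s
* ·)` and `f ((r - s) * ·)`. Extremality forces the first to equal `f`. -/
theorem extremePoints_states_mul (hS : IsSemiring S) (h : IsArchimedean S) {f : A → ℝ}
    (hf : f ∈ (states S).extremePoints ℝ) (a b : A) : f (a * b) = f a * f b := by
  obtain ⟨hf, hext⟩ := hf
  have key : ∀ s ∈ S, ∀ r : ℝ, algebraMap ℝ A r - s ∈ S → 0 < f s → f s < r →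
      ∀ a, f (s * a) = f s * f a := by
    intro s hs r hrs h0 hr a
    have hr0 : 0 < r := h0.trans hr
    have hsub : f (algebraMap ℝ A r - s) = r - f s := by
      rw [states_map_sub hf, states_map_algebraMap hf]
    have h0' : 0 < f (algebraMap ℝ A r - s) := by rw [hsub]; linarith
    have := hext (states_mul_div hS hf hs h0) (states_mul_div hS hf hrs h0')
      ⟨f s / r, (r - f s) / r, by positivity, div_pos (by linarith) hr0, by field_simp; ring, by
        funext x
        have h1 : r - f s ≠ 0 := by linarith
        simp only [Pi.add_apply, Pi.smul_apply, smul_eq_mul, hsub, sub_mul, states_map_sub hf]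
        rw [← Algebra.smul_def, hf.2.1]
        field_simp
        ring⟩
    have := congrFun this a
    field_simp at this
    linarith
  have key2 : ∀ s ∈ S, ∀ a, f (s * a) = f s * f a := by
    intro s hs a
    obtain ⟨r, hr, h1, -⟩ := h.exists_bound s
    have e0 := hf.2.2.1 s hs
    have e1 := hf.2.2.1 _ h1
    rw [states_map_sub hf, states_map_algebraMap hf] at e1
    have e2 : f (s + 1) = f s + 1 := by rw [hf.1, hf.2.2.2]
    -- Shifting by units turns `0 ≤ f s ≤ r` into the strict inequalities `0 < f (s + 1) < r + 2`.
    have := key (s + 1) (hS.add_mem _ hs _ hS.one_mem) (r + 2)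
      (by
        have := hS.add_mem _ h1 _ hS.one_mem
        convert this using 1
        rw [map_add, map_ofNat]; ring) (by linarith) (by linarith) a
    rw [e2, add_mul, one_mul, hf.1] at this
    linarith
  -- An arbitrary `a` is the difference of `r + a ∈ S` and a scalar.
  obtain ⟨r, hr, -, h1⟩ := h.exists_bound a
  have := key2 _ h1 b
  rw [add_mul, hf.1, hf.1, states_map_algebraMap hf, ← Algebra.smul_def, hf.2.1] at this
  linarith

theorem exists_positiveCharacter_of_extremePoints_states (hS : IsSemiring S)
    (h : IsArchimedean S) {f : A → ℝ} (hf : f ∈ (states S).extremePoints ℝ) :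
    ∃ φ ∈ positiveCharacters S, ∀ a, φ a = f a := by
  have hs := hf.1
  exact ⟨{ toFun := f, map_one' := hs.2.2.2, map_mul' := extremePoints_states_mul hS h hf,
           map_zero' := by simpa using states_map_algebraMap hs 0, map_add' := hs.1,
           commutes' := states_map_algebraMap hs }, hs.2.2.1, fun _ => rfl⟩

theorem nonneg_of_mem_states (hS : IsSemiring S) (h : IsArchimedean S) {a : A}
    (ha : ∀ φ ∈ positiveCharacters S, 0 ≤ φ a) {f : A → ℝ} (hf : f ∈ states S) : 0 ≤ f a := by
  rw [← closure_convexHull_extremePoints (isCompact_states h) (convex_states S)] at hf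
  have hc : IsClosed {g : A → ℝ | 0 ≤ g a} := isClosed_le continuous_const (continuous_apply a)
  have hconv : Convex ℝ {g : A → ℝ | 0 ≤ g a} :=
    convex_halfSpace_ge (LinearMap.proj a : (A → ℝ) →ₗ[ℝ] ℝ).isLinear 0
  refine closure_minimal (convexHull_min ?_ hconv) hc hf
  intro g hg
  obtain ⟨φ, hφ, hg⟩ := exists_positiveCharacter_of_extremePoints_states hS h hg
  exact (ha φ hφ).trans_eq (hg a)

/-- A linear functional that is nonnegative on an Archimedean semiring is nonnegative on every
element on which all positive characters are nonnegative. -/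
theorem nonneg_of_forall_positiveCharacters (hS : IsSemiring S) (h : IsArchimedean S)
    (f : A →ₗ[ℝ] ℝ) (hf : ∀ s ∈ S, 0 ≤ f s) {a : A}
    (ha : ∀ φ ∈ positiveCharacters S, 0 ≤ φ a) : 0 ≤ f a := by
  have hmap : ∀ r : ℝ, f (algebraMap ℝ A r) = r * f 1 := fun r => by
    rw [Algebra.algebraMap_eq_smul_one, map_smul, smul_eq_mul]
  -- If `f 1 = 0`, then `f` kills scalars and `f a = f (r + a) ≥ 0`; otherwise `f` is normalized to
  -- a state.
  rcases (hf 1 hS.one_mem).eq_or_lt with h0 | h0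
  · obtain ⟨r, hr, h1, h2⟩ := h.exists_bound a
    have e2 := hf _ h2
    rw [map_add, hmap, ← h0] at e2
    linarith
  · have : (fun x => f x / f 1) ∈ states S := by
      refine ⟨fun a b => ?_, fun r a => ?_, fun t ht => ?_, div_self h0.ne'⟩
      · simp only [map_add, add_div]
      · simp only [map_smul, smul_eq_mul, mul_div_assoc]
      · exact div_nonneg (hf t ht) h0.le
    have := nonneg_of_mem_states hS h ha this
    simpa [div_mul_cancel₀ _ h0.ne'] using mul_nonneg this h0.le

end States

/-! ### Stone–Weierstrass and partitions of unity on compact sets of characters -/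

section Approximation

variable {A : Type*} [CommRing A] [Algebra ℝ A]

/-- Evaluation of algebra elements on a set of characters, as continuous functions. -/
def evalHom (K : Set (Character A)) : A →ₐ[ℝ] C(K, ℝ) where
  toFun a := ⟨fun φ => (φ : Character A) a,
    (Character.continuous_eval a).comp continuous_subtype_val⟩
  map_one' := by ext; simp
  map_mul' _ _ := by ext; simp
  map_zero' := by ext; simp
  map_add' _ _ := by ext; simp
  commutes' _ := by ext; simp

theorem exists_eval_near {K : Set (Character A)} (hK : IsCompact K) {f : K → ℝ}
    (hf : Continuous f) {δ : ℝ} (hδ : 0 < δ) :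
    ∃ a : A, ∀ φ : K, |(φ : Character A) a - f φ| < δ := by
  have : CompactSpace K := isCompact_iff_compactSpace.1 hK
  have hsep : (evalHom K).range.SeparatesPoints := by
    intro φ ψ hne
    have : ∃ a, (φ : Character A) a ≠ (ψ : Character A) a := by
      by_contra! hall
      exact hne (Subtype.ext (AlgHom.ext hall))
    obtain ⟨a, ha⟩ := this
    exact ⟨_, ⟨evalHom K a, ⟨a, rfl⟩, rfl⟩, ha⟩
  obtain ⟨⟨_, a, rfl⟩, ha⟩ :=
    ContinuousMap.exists_mem_subalgebra_near_continuous_of_separatesPoints _ hsep f hf δ hδ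
  exact ⟨a, ha⟩

/-- On a compact set of characters, a finite family in `A` is uniformly approximated by
combinations of its values at finitely many points, with coefficients nonnegative on the set. -/
theorem exists_nonneg_interpolation {K : Set (Character A)} (hK : IsCompact K) {ι : Type*}
    [Fintype ι] (c : ι → A) {ε : ℝ} (hε : 0 < ε) :
    ∃ (t : Finset K) (e : t → A), (∀ i, ∀ φ ∈ K, 0 ≤ φ (e i)) ∧
      ∀ k, ∀ φ ∈ K, |φ (c k) - ∑ i, φ (e i) * (i : Character A) (c k)| ≤ ε := by
  have : CompactSpace K := isCompact_iff_compactSpace.1 hK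
  have hcont : ∀ a : A, Continuous fun φ : K => (φ : Character A) a := fun a =>
    (Character.continuous_eval a).comp continuous_subtype_val
  let U : K → Set K := fun x =>
    {y | ∀ k, |(y : Character A) (c k) - (x : Character A) (c k)| < ε / 2}
  have hU : ∀ x, IsOpen (U x) := fun x => by
    simp only [U, Set.ofPred_forall]
    exact isOpen_iInter_of_finite fun k =>
      isOpen_lt ((hcont _).sub continuous_const).abs continuous_const
  obtain ⟨t, ht⟩ := isCompact_univ.elim_finite_subcover U hU fun x _ =>
    Set.mem_iUnion.2 ⟨x, fun k => by simpa using half_pos hε⟩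
  obtain ⟨ρ, hρ⟩ := PartitionOfUnity.exists_isSubordinate isClosed_univ
    (fun i : t => U i) (fun i => hU i) (fun x hx => by simpa using ht hx)
  set M : ℝ := ∑ i : t, ∑ k, |(i : Character A) (c k)| with hM
  have hM0 : 0 ≤ M := by positivity
  -- Chosen so that `2 * δ * M ≤ ε / 2`.
  have hδ : 0 < ε / (4 * (M + 1)) := by positivity
  set δ := ε / (4 * (M + 1)) with hδdef
  -- Approximating `ρ i + δ` within `δ` keeps `e i` nonnegative on `K`, at the cost of an error up
  -- to `2 * δ` from `ρ i`.
  choose e he using fun i : t =>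
    exists_eval_near hK (f := fun φ => ρ i φ + δ) (by fun_prop) hδ
  refine ⟨t, e, fun i φ hφ => ?_, fun k φ hφ => ?_⟩
  · have h1 := (abs_lt.1 (he i ⟨φ, hφ⟩)).1
    have h2 := ρ.nonneg i ⟨φ, hφ⟩
    simp only at h1
    linarith
  · have hsum : ∑ i, ρ i ⟨φ, hφ⟩ = 1 := by
      rw [← finsum_eq_sum_of_fintype]
      exact ρ.sum_eq_one (Set.mem_univ _)
    have hsplit : φ (c k) - ∑ i, φ (e i) * (i : Character A) (c k) =
        ∑ i, (ρ i ⟨φ, hφ⟩ * (φ (c k) - (i : Character A) (c k)) -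
          (φ (e i) - ρ i ⟨φ, hφ⟩) * (i : Character A) (c k)) := by
      simp only [mul_sub, sub_mul, Finset.sum_sub_distrib, ← Finset.sum_mul, hsum]
      ring
    rw [hsplit]
    calc _ ≤ ∑ i, (ρ i ⟨φ, hφ⟩ * (ε / 2) + 2 * δ * ∑ k, |(i : Character A) (c k)|) := by
          refine (Finset.abs_sum_le_sum_abs _ _).trans (Finset.sum_le_sum fun i _ => ?_)
          refine (abs_sub _ _).trans (add_le_add ?_ ?_)
          · rw [abs_mul, abs_of_nonneg (ρ.nonneg i _)]
            by_cases h0 : ρ i ⟨φ, hφ⟩ = 0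
            · simp [h0]
            · exact mul_le_mul_of_nonneg_left (hρ i (subset_tsupport _ h0) k).le (ρ.nonneg i _)
          · rw [abs_mul]
            refine mul_le_mul ?_ ?_ (abs_nonneg _) (by positivity)
            · have h1 := abs_lt.1 (he i ⟨φ, hφ⟩)
              simp only at h1
              rw [abs_le]
              constructor <;> linarith [h1.1, h1.2]
            · exact Finset.single_le_sum (f := fun k => |(i : Character A) (c k)|)
                (fun _ _ => abs_nonneg _) (Finset.mem_univ k)
      _ = ε / 2 + 2 * δ * M := by
          rw [Finset.sum_add_distrib, ← Finset.sum_mul, hsum, one_mul, ← Finset.mul_sum]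
      _ ≤ ε := by
          have : 2 * δ * M ≤ ε / 2 := by
            rw [hδdef, mul_div_assoc', div_mul_eq_mul_div, div_le_div_iff₀ (by positivity)
              (by positivity)]
            nlinarith
          linarith

end Approximation

/-! ### Positivity of the functional on the cylinder -/

section Positivity

open Polynomial

variable {A : Type*} [CommRing A] [Algebra ℝ A] {S : Set A} {J : Set ℝ} {L : A[X] →ₗ[ℝ] ℝ}

theorem pairCharacter_apply (φ : Character A) (η : ℝ) (a : A[X]) :
    pairCharacter φ η a = (a.map (φ : A →+* ℝ)).eval η := by
  have hη : (φ : A →+* ℝ) (algebraMap ℝ A η) = η := φ.commutes η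
  have := hom_eval₂ a (RingHom.id A) (φ : A →+* ℝ) (algebraMap ℝ A η)
  rw [hη, RingHom.comp_id] at this
  rw [eval_map, ← this]
  rfl

theorem nonneg_C_mul_map (hS : IsSemiring S) (h : IsArchimedean S)
    (hL : ∀ a ∈ tensorCone S (posPolynomials J), 0 ≤ L a) {a : A}
    (ha : ∀ φ ∈ positiveCharacters S, 0 ≤ φ a) {q : ℝ[X]} (hq : q ∈ posPolynomials J) :
    0 ≤ L (C a * q.map (algebraMap ℝ A)) := by
  let f : A →ₗ[ℝ] ℝ :=
    { toFun := fun a => L (C a * q.map (algebraMap ℝ A))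
      map_add' := fun a b => by rw [C_add, add_mul, map_add]
      map_smul' := fun r a => by
        rw [← smul_C, smul_mul_assoc, map_smul, RingHom.id_apply] }
  exact nonneg_of_forall_positiveCharacters hS h f
    (fun s hs => hL _ ⟨1, fun _ => s, fun _ => q, fun _ => hs, fun _ => hq, by simp⟩) ha

/-- With `W = 1 + X ^ (2 * k)`, the sum `(ε + a)(W + X ^ k) + (ε - a)(W - X ^ k)` equals `2εW + 2aX
^ k`; exchanging the signs of `X ^ k` gives `2εW - 2aX ^ k`. Both `W ± X ^ k` are nonnegative on all
of `ℝ`. -/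
theorem abs_C_mul_X_pow_le (hS : IsSemiring S) (h : IsArchimedean S)
    (hL : ∀ a ∈ tensorCone S (posPolynomials J), 0 ≤ L a) {a : A} {ε : ℝ}
    (ha : ∀ φ ∈ positiveCharacters S, |φ a| ≤ ε) (k : ℕ) :
    |L (C a * X ^ k)| ≤ ε * L (1 + X ^ (2 * k)) := by
  have hq1 : (1 + X ^ (2 * k) + X ^ k : ℝ[X]) ∈ posPolynomials J := fun t _ => by
    simp only [eval_add, eval_one, eval_pow, eval_X, mul_comm 2 k, pow_mul]
    nlinarith [sq_nonneg (t ^ k + 1 / 2)]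
  have hq2 : (1 + X ^ (2 * k) - X ^ k : ℝ[X]) ∈ posPolynomials J := fun t _ => by
    simp only [eval_add, eval_sub, eval_one, eval_pow, eval_X, mul_comm 2 k, pow_mul]
    nlinarith [sq_nonneg (t ^ k - 1 / 2)]
  have hp : ∀ φ ∈ positiveCharacters S, 0 ≤ φ (algebraMap ℝ A ε + a) := fun φ hφ => by
    have := abs_le.1 (ha φ hφ)
    rw [map_add, AlgHom.commutes, Algebra.algebraMap_self, RingHom.id_apply]
    linarith [this.1]
  have hm : ∀ φ ∈ positiveCharacters S, 0 ≤ φ (algebraMap ℝ A ε - a) := fun φ hφ => by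
    have := abs_le.1 (ha φ hφ)
    rw [map_sub, AlgHom.commutes, Algebra.algebraMap_self, RingHom.id_apply]
    linarith [this.2]
  have hC : ∀ b : A[X], L (C (algebraMap ℝ A ε) * b) = ε * L b := fun b => by
    rw [← smul_eq_C_mul, algebraMap_smul, map_smul, smul_eq_mul]
  have e1 := nonneg_C_mul_map hS h hL hp hq1
  have e2 := nonneg_C_mul_map hS h hL hm hq2
  have e3 := nonneg_C_mul_map hS h hL hp hq2
  have e4 := nonneg_C_mul_map hS h hL hm hq1
  simp only [Polynomial.map_add, Polynomial.map_sub, Polynomial.map_one, Polynomial.map_pow,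
    map_X, add_mul, sub_mul, hC, map_add, map_sub, mul_add, mul_sub] at *
  rw [abs_le]
  constructor <;> linarith

theorem nonneg_of_nonneg_on_cylinder (hS : IsSemiring S) (h : IsArchimedean S)
    (hL : ∀ a ∈ tensorCone S (posPolynomials J), 0 ≤ L a) {a : A[X]}
    (ha : ∀ χ ∈ cylinder (positiveCharacters S) J, 0 ≤ χ a) : 0 ≤ L a := by
  set N := a.natDegree + 1
  set M := ∑ k ∈ Finset.range N, L (1 + X ^ (2 * k)) with hM
  have key : ∀ ε > 0, -(ε * M) ≤ L a := by
    intro ε hε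
    obtain ⟨t, e, he, happ⟩ := exists_nonneg_interpolation (isCompact_positiveCharacters h)
      (fun k : Fin N => a.coeff k) hε
    -- Freezing the coefficients of `a` at the character `i` gives a real polynomial in `Pos(J)`, by
    -- the hypothesis on `a`.
    let b : A[X] := ∑ i, C (e i) * (a.map ((i : Character A) : A →+* ℝ)).map (algebraMap ℝ A)
    have hb : 0 ≤ L b := by
      rw [map_sum]
      refine Finset.sum_nonneg fun i _ => nonneg_C_mul_map hS h hL (he i) fun η hη => ?_
      rw [← pairCharacter_apply]
      exact ha _ ⟨_, i.1.2, η, hη, rfl⟩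
    have hcoeff : ∀ k, (a - b).coeff k =
        a.coeff k - ∑ i, e i * algebraMap ℝ A ((i : Character A) (a.coeff k)) := by
      intro k
      simp [b]
    have hdeg : (a - b).natDegree < N := by
      refine Nat.lt_succ_of_le (natDegree_le_iff_coeff_eq_zero.2 fun k hk => ?_)
      rw [hcoeff, coeff_eq_zero_of_natDegree_lt hk]
      simp
    have hr : L (a - b) = ∑ k ∈ Finset.range N, L (C ((a - b).coeff k) * X ^ k) := by
      conv_lhs => rw [as_sum_range' (a - b) N hdeg]
      simp only [C_mul_X_pow_eq_monomial, map_sum]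
    have hle : |L (a - b)| ≤ ε * M := by
      rw [hr, hM, Finset.mul_sum]
      refine (Finset.abs_sum_le_sum_abs _ _).trans (Finset.sum_le_sum fun k hk => ?_)
      refine abs_C_mul_X_pow_le hS h hL (fun φ hφ => ?_) k
      have := happ ⟨k, Finset.mem_range.1 hk⟩ φ hφ
      rw [hcoeff]
      simpa [map_sum] using this
    have := (abs_le.1 hle).1
    rw [map_sub] at this
    linarith
  have hlim : Tendsto (fun ε : ℝ => -(ε * M)) (𝓝[>] 0) (𝓝 0) := by
    have : Tendsto (fun ε : ℝ => -(ε * M)) (𝓝 0) (𝓝 (-(0 * M))) := by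
      apply Continuous.tendsto; fun_prop
    rw [zero_mul, neg_zero] at this
    exact this.mono_left nhdsWithin_le_nhds
  exact le_of_tendsto hlim (eventually_mem_nhdsWithin.mono fun ε hε => key ε hε)

/-- A character of `A[X]` is determined by its restriction to constants and its value at `X`, so
membership is a closed condition on these two. -/
theorem isClosed_cylinder (hJ : IsClosed J) :
    IsClosed (cylinder (positiveCharacters S) J) := by
  have : cylinder (positiveCharacters S) J =
      {χ : Character A[X] | (∀ s ∈ S, 0 ≤ χ (C s)) ∧ χ X ∈ J} := by
    ext χ
    constructor
    · rintro ⟨φ, hφ, η, hη, rfl⟩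
      refine ⟨fun s hs => ?_, ?_⟩
      · simpa [pairCharacter_apply] using hφ s hs
      · simpa [pairCharacter_apply] using hη
    · rintro ⟨h1, h2⟩
      refine ⟨χ.comp CAlgHom, fun s hs => h1 s hs, χ X, h2, ?_⟩
      ext a
      · simp [pairCharacter_apply]
      · simp [pairCharacter_apply]
  rw [this]
  simp only [Set.ofPred_and, Set.ofPred_forall]
  refine IsClosed.inter ?_ (hJ.preimage (Character.continuous_eval X))
  exact isClosed_iInter fun a => isClosed_iInter fun _ =>
    isClosed_le continuous_const (Character.continuous_eval _)

end Positivity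

/-! ### Haviland's theorem -/

section Haviland

open CompactlySupported
open scoped NNReal

variable {B : Type*} [CommRing B] [Algebra ℝ B]

/-- The sum of squares of finitely many generators works: bounding it bounds each generator, hence
every element. It plays the role of `‖x‖²` on `ℝⁿ`. -/
theorem exists_isCompact_sublevel (hB : Algebra.FiniteType ℝ B) :
    ∃ w : B, (∀ χ : Character B, 0 ≤ χ w) ∧
      ∀ r : ℝ, IsCompact {χ : Character B | χ w ≤ r} := by
  obtain ⟨s, hs⟩ := hB.out
  have hw : ∀ χ : Character B, χ (∑ x ∈ s, x ^ 2) = ∑ x ∈ s, χ x ^ 2 := fun χ => by simp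
  refine ⟨∑ x ∈ s, x ^ 2, fun χ => ?_, fun r => ?_⟩
  · rw [hw]; positivity
  · refine Character.isCompact_of_isClosed_of_bounded
      (isClosed_le (Character.continuous_eval _) continuous_const) fun b => ?_
    have hb : b ∈ Algebra.adjoin ℝ (s : Set B) := by rw [hs]; trivial
    induction hb using Algebra.adjoin_induction with
    | mem x hx =>
      refine ⟨1 + r, fun χ hχ => ?_⟩
      have h1 : χ x ^ 2 ≤ r := by
        refine le_trans ?_ ((hw χ).symm.trans_le hχ)
        exact Finset.single_le_sum (f := fun x => χ x ^ 2) (fun _ _ => sq_nonneg _) hx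
      rw [abs_le]
      constructor <;> nlinarith [sq_nonneg (χ x - 1), sq_nonneg (χ x + 1)]
    | algebraMap t => exact ⟨|t|, fun χ _ => by simp⟩
    | add x y _ _ hx hy =>
      obtain ⟨u, hu⟩ := hx
      obtain ⟨v, hv⟩ := hy
      refine ⟨u + v, fun χ hχ => ?_⟩
      rw [map_add]
      exact (abs_add_le _ _).trans (add_le_add (hu χ hχ) (hv χ hχ))
    | mul x y _ _ hx hy =>
      obtain ⟨u, hu⟩ := hx
      obtain ⟨v, hv⟩ := hy
      refine ⟨u * v, fun χ hχ => ?_⟩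
      rw [map_mul, abs_mul]
      exact mul_le_mul (hu χ hχ) (hv χ hχ) (abs_nonneg _) ((abs_nonneg _).trans (hu χ hχ))

theorem Character.locallyCompactSpace (hB : Algebra.FiniteType ℝ B) :
    LocallyCompactSpace (Character B) := by
  obtain ⟨w, -, hw⟩ := exists_isCompact_sublevel hB
  have : WeaklyLocallyCompactSpace (Character B) := ⟨fun χ => ⟨_, hw (χ w + 1),
    mem_of_superset ((isOpen_lt (continuous_eval w) continuous_const).mem_nhds
      (lt_add_one (χ w))) fun ψ (hψ : ψ w < χ w + 1) => hψ.le⟩⟩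
  infer_instance

/-- The pairs of an algebra element and a compactly supported function whose sum is nonnegative
on `E`. -/
def nonnegPairs (E : Set (Character B)) : PointedCone ℝ (B × C_c(Character B, ℝ)) where
  carrier := {p | ∀ χ ∈ E, 0 ≤ χ p.1 + p.2 χ}
  zero_mem' χ _ := by simp
  add_mem' {p q} hp hq χ hχ := by
    have h1 := hp χ hχ
    have h2 := hq χ hχ
    simp only [Prod.fst_add, Prod.snd_add, map_add, CompactlySupportedContinuousMap.coe_add,
      Pi.add_apply]
    linarith
  smul_mem' r p hp χ hχ := by
    have h1 := mul_nonneg r.2 (hp χ hχ)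
    have h2 : χ (r • p).1 = r * χ p.1 := map_smul χ (r : ℝ) p.1
    have h3 : (r • p).2 χ = r * p.2 χ := rfl
    rw [h2, h3, ← mul_add]
    exact h1

/-- A functional nonnegative on the elements that are nonnegative on `E` extends to compactly
supported functions. -/
theorem exists_extension_compactlySupported {E : Set (Character B)} {L : B →ₗ[ℝ] ℝ}
    (hL : ∀ b, (∀ χ ∈ E, 0 ≤ χ b) → 0 ≤ L b) :
    ∃ g : C_c(Character B, ℝ) →ₗ[ℝ] ℝ,
      ∀ b f, (∀ χ ∈ E, 0 ≤ χ b + f χ) → 0 ≤ L b + g f := by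
  let F : (B × C_c(Character B, ℝ)) →ₗ.[ℝ] ℝ :=
    ⟨LinearMap.range (LinearMap.inl ℝ B C_c(Character B, ℝ)),
      (L ∘ₗ LinearMap.fst ℝ B C_c(Character B, ℝ)) ∘ₗ Submodule.subtype _⟩
  obtain ⟨g, hg1, hg2⟩ := riesz_extension (nonnegPairs E) F
    (by
      rintro ⟨_, b, rfl⟩ hb
      refine hL b fun χ hχ => ?_
      simpa using hb χ hχ)
    (by
      rintro ⟨b, f⟩
      obtain ⟨M, hM⟩ := f.hasCompactSupport.exists_bound_of_continuous f.continuous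
      -- Adding `(M - b, 0)` to `(b, f)` leaves `M + f`, nonnegative since `M` bounds `|f|`.
      refine ⟨⟨_, algebraMap ℝ B M - b, rfl⟩, fun χ _ => ?_⟩
      have := (abs_le.1 (hM χ)).1
      simp only [LinearMap.inl_apply, Prod.mk_add_mk, sub_add_cancel, zero_add,
        AlgHom.commutes, Algebra.algebraMap_self, RingHom.id_apply]
      linarith)
  refine ⟨g ∘ₗ LinearMap.inr ℝ B _, fun b f hbf => ?_⟩
  have h1 : g (b, 0) = L b := hg1 ⟨_, b, rfl⟩
  have h2 := hg2 (b, f) hbf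
  rw [← h1]
  simpa [← map_add] using h2

/-- A continuous cutoff that is `1` where `w ≤ n` and vanishes where `n + 1 ≤ w`. -/
noncomputable def cutoff (w : B) (n : ℕ) (χ : Character B) : ℝ := max 0 (min 1 (n + 1 - χ w))

theorem cutoff_nonneg (w : B) (n : ℕ) (χ : Character B) : 0 ≤ cutoff w n χ := le_max_left _ _

theorem cutoff_le_one (w : B) (n : ℕ) (χ : Character B) : cutoff w n χ ≤ 1 :=
  max_le zero_le_one (min_le_left _ _)

theorem cutoff_eq_one {w : B} {n : ℕ} {χ : Character B} (h : χ w ≤ n) : cutoff w n χ = 1 := by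
  rw [cutoff, min_eq_left (by linarith), max_eq_right zero_le_one]

theorem cutoff_eq_zero {w : B} {n : ℕ} {χ : Character B} (h : n + 1 < χ w) :
    cutoff w n χ = 0 := by
  rw [cutoff, max_eq_left ((min_le_right _ _).trans (by linarith))]

theorem continuous_cutoff (w : B) (n : ℕ) : Continuous (cutoff w n) :=
  continuous_const.max
    (continuous_const.min (continuous_const.sub (Character.continuous_eval w)))

theorem tendsto_cutoff_mul (w b : B) (χ : Character B) :
    Tendsto (fun n => cutoff w n χ * χ b) atTop (𝓝 (χ b)) := by
  refine tendsto_const_nhds.congr' ?_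
  obtain ⟨N, hN⟩ := exists_nat_ge (χ w)
  filter_upwards [eventually_ge_atTop N] with n hn
  rw [cutoff_eq_one (hN.trans (Nat.cast_le.2 hn)), one_mul]

/-- The product of a cutoff with the evaluation at `b`, as a compactly supported function. -/
noncomputable def cutoffMul {w : B} (hw : ∀ r : ℝ, IsCompact {χ : Character B | χ w ≤ r}) (n : ℕ)
    (b : B) : C_c(Character B, ℝ) where
  toFun χ := cutoff w n χ * χ b
  continuous_toFun := (continuous_cutoff w n).mul (Character.continuous_eval b)
  hasCompactSupport' := HasCompactSupport.intro (hw (n + 1)) fun χ hχ => by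
    rw [cutoff_eq_zero (not_le.1 hχ), zero_mul]

theorem cutoffMul_apply {w : B} (hw : ∀ r : ℝ, IsCompact {χ : Character B | χ w ≤ r}) (n : ℕ)
    (b : B) (χ : Character B) : cutoffMul hw n b χ = cutoff w n χ * χ b := rfl

/-- The error lives where `w > n`, and there `(1 + w) / (n + 1) ≥ 1`, while `|χ b| ≤ 1 + χ b ^ 2`.
The bound is again the evaluation of an element of `B`, so `L` applies to it. -/
theorem abs_sub_cutoff_mul_le {w : B} {χ : Character B} (hw : 0 ≤ χ w) (b : B) (n : ℕ) :
    |χ b - cutoff w n χ * χ b| ≤ (n + 1 : ℝ)⁻¹ * χ ((1 + b ^ 2) * (1 + w)) := by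
  have hn : (0 : ℝ) < n + 1 := by positivity
  simp only [map_mul, map_add, map_one, map_pow]
  rcases le_or_gt (χ w) n with h | h
  · rw [cutoff_eq_one h, one_mul, sub_self, abs_zero]
    positivity
  · have h1 := cutoff_nonneg w n χ
    have h2 := cutoff_le_one w n χ
    calc |χ b - cutoff w n χ * χ b| = (1 - cutoff w n χ) * |χ b| := by
          rw [← one_sub_mul, abs_mul, abs_of_nonneg (by linarith)]
      _ ≤ 1 * |χ b| := by gcongr; linarith
      _ ≤ 1 + χ b ^ 2 := by rw [← sq_abs]; nlinarith [sq_nonneg (|χ b| - 1), abs_nonneg (χ b)]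
      _ ≤ (n + 1 : ℝ)⁻¹ * ((1 + χ b ^ 2) * (1 + χ w)) := by
          rw [inv_mul_eq_div, le_div_iff₀ hn]
          gcongr _ * ?_
          linarith

/-- **Haviland's theorem** for a closed set of characters of a finitely generated algebra. -/
theorem isMomentFunctional_of_nonneg (hB : Algebra.FiniteType ℝ B) {E : Set (Character B)}
    (hE : IsClosed E) {L : B →ₗ[ℝ] ℝ} (hL : ∀ b, (∀ χ ∈ E, 0 ≤ χ b) → 0 ≤ L b) :
    IsMomentFunctional E L := by
  have := Character.locallyCompactSpace hB
  obtain ⟨w, hw0, hw⟩ := exists_isCompact_sublevel hB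
  obtain ⟨g, hg⟩ := exists_extension_compactlySupported hL
  have hgpos : ∀ f : C_c(Character B, ℝ), (∀ χ ∈ E, 0 ≤ f χ) → 0 ≤ g f := fun f hf => by
    simpa using hg 0 f (by simpa using hf)
  let Λ : C_c(Character B, ℝ) →ₚ[ℝ] ℝ :=
    PositiveLinearMap.mk₀ g fun f hf => hgpos f fun χ _ => hf χ
  let μ := RealRMK.rieszMeasure Λ
  have hint : ∀ f : C_c(Character B, ℝ), ∫ χ, f χ ∂μ = g f :=
    RealRMK.integral_rieszMeasure Λ
  have hmeas : ∀ b : B, Measurable fun χ : Character B => χ b := fun b =>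
    (Character.continuous_eval b).measurable
  -- Fatou's lemma: the cutoffs of `b` lie below `b`, so their integrals are at most `L b`.
  have hnonneg : ∀ b : B, (∀ χ : Character B, 0 ≤ χ b) →
      Integrable (fun χ : Character B => χ b) μ := by
    intro b hb
    refine ⟨(hmeas b).aestronglyMeasurable, ?_⟩
    rw [hasFiniteIntegral_iff_ofReal (ae_of_all _ hb)]
    refine lt_of_le_of_lt ?_ (ENNReal.ofReal_lt_top (r := L b))
    have hlim : ∀ χ : Character B, ENNReal.ofReal (χ b) =
        liminf (fun n => ENNReal.ofReal (cutoff w n χ * χ b)) atTop := fun χ =>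
      ((ENNReal.continuous_ofReal.tendsto _).comp (tendsto_cutoff_mul w b χ)).liminf_eq.symm
    simp_rw [hlim]
    refine (lintegral_liminf_le fun n =>
      (((continuous_cutoff w n).measurable.mul (hmeas b)).ennreal_ofReal)).trans ?_
    refine liminf_le_of_frequently_le' (Frequently.of_forall fun n => ?_)
    have hfn : ∀ χ, 0 ≤ cutoffMul hw n b χ := fun χ => mul_nonneg (cutoff_nonneg w n χ) (hb χ)
    have hi : Integrable (cutoffMul hw n b) μ :=
      (cutoffMul hw n b).continuous.integrable_of_hasCompactSupport
        (cutoffMul hw n b).hasCompactSupport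
    have := ofReal_integral_eq_lintegral_ofReal hi (ae_of_all _ hfn)
    rw [hint] at this
    refine (this.symm.trans_le (ENNReal.ofReal_le_ofReal ?_))
    have := hg b (-cutoffMul hw n b) fun χ _ => by
      have h1 := mul_le_mul_of_nonneg_right (cutoff_le_one w n χ) (hb χ)
      simp only [CompactlySupportedContinuousMap.coe_neg, Pi.neg_apply, cutoffMul_apply]
      linarith
    rw [map_neg] at this
    linarith
  have hintegrable : ∀ b : B, Integrable (fun χ : Character B => χ b) μ := by
    intro b
    refine (hnonneg (1 + b ^ 2) fun χ => ?_).mono' (hmeas b).aestronglyMeasurable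
      (ae_of_all _ fun χ => ?_)
    · simp only [map_add, map_one, map_pow]; positivity
    · simp only [map_add, map_one, map_pow, Real.norm_eq_abs]
      rw [← sq_abs]
      nlinarith [sq_nonneg (|χ b| - 1), abs_nonneg (χ b)]
  have heq : ∀ b : B, L b = ∫ χ, χ b ∂μ := by
    intro b
    have h1 : Tendsto (fun n => g (cutoffMul hw n b)) atTop (𝓝 (∫ χ, χ b ∂μ)) := by
      simp_rw [← hint]
      refine tendsto_integral_of_dominated_convergence (fun χ => |χ b|)
        (fun n => (cutoffMul hw n b).continuous.measurable.aestronglyMeasurable)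
        (hintegrable b).abs (fun n => ae_of_all _ fun χ => ?_)
        (ae_of_all _ fun χ => tendsto_cutoff_mul w b χ)
      rw [cutoffMul_apply, Real.norm_eq_abs, abs_mul, abs_of_nonneg (cutoff_nonneg w n χ)]
      exact mul_le_of_le_one_left (abs_nonneg _) (cutoff_le_one w n χ)
    -- Positivity of the extension turns the pointwise bound on `b` minus its cutoff into `|g
    -- (cutoffMul hw n b) - L b| ≤ L ((1 + b ^ 2) * (1 + w)) / (n + 1)`.
    have h2 : Tendsto (fun n => g (cutoffMul hw n b)) atTop (𝓝 (L b)) := by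
      have hz : Tendsto (fun n : ℕ => (n + 1 : ℝ)⁻¹ * L ((1 + b ^ 2) * (1 + w))) atTop (𝓝 0) := by
        simpa using (tendsto_one_div_add_atTop_nhds_zero_nat (𝕜 := ℝ)).mul_const
          (L ((1 + b ^ 2) * (1 + w)))
      refine tendsto_iff_dist_tendsto_zero.2 (squeeze_zero (fun _ => dist_nonneg) (fun n => ?_) hz)
      have hb := fun χ : Character B => abs_le.1 (abs_sub_cutoff_mul_le (hw0 χ) b n)
      have e1 := hg ((n + 1 : ℝ)⁻¹ • ((1 + b ^ 2) * (1 + w)) - b) (cutoffMul hw n b)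
        fun χ _ => by
          rw [map_sub, map_smul, smul_eq_mul, cutoffMul_apply]
          linarith [(hb χ).2]
      have e2 := hg ((n + 1 : ℝ)⁻¹ • ((1 + b ^ 2) * (1 + w)) + b) (-cutoffMul hw n b)
        fun χ _ => by
          rw [map_add, map_smul, smul_eq_mul, CompactlySupportedContinuousMap.coe_neg,
            Pi.neg_apply, cutoffMul_apply]
          linarith [(hb χ).1]
      rw [map_sub, map_smul, smul_eq_mul] at e1
      rw [map_add, map_smul, smul_eq_mul, map_neg] at e2
      rw [Real.dist_eq, abs_le]
      constructor <;> linarith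
    exact tendsto_nhds_unique h2 h1
  -- Finiteness upgrades the regularity of the Riesz measure to inner regularity on all measurable
  -- sets.
  have hfin : IsFiniteMeasure μ := by
    have := hintegrable 1
    simp only [map_one] at this
    exact (integrable_const_iff_isFiniteMeasure one_ne_zero).1 this
  -- A compact `K` in `Eᶜ` has measure at most `g f` for a bump function `f` that is `1` on `K` and
  -- `0` on `E`; `g` is nonnegative on `-f` because only values on `E` count.
  have hnull : μ Eᶜ = 0 := by
    rw [hE.isOpen_compl.measure_eq_iSup_isCompact]
    simp only [ENNReal.iSup_eq_zero]
    intro K hKE hK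
    obtain ⟨f, hf1, hf0, hfc, hf⟩ := exists_continuous_one_zero_of_isCompact hK hE
      (Set.disjoint_left.2 fun χ hχ => hKE hχ)
    let f' : C_c(Character B, ℝ) := ⟨f, hfc⟩
    have hle : μ K ≤ ENNReal.ofReal (Λ f') :=
      RealRMK.rieszMeasure_le_of_eq_one Λ (fun χ => (hf χ).1) hK fun χ hχ => hf1 hχ
    have h0 := hgpos (-f') fun χ hχ => (neg_eq_zero.2 (hf0 hχ)).ge
    rw [map_neg] at h0
    refine le_antisymm (hle.trans (ENNReal.ofReal_eq_zero.2 ?_).le) zero_le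
    exact neg_nonneg.1 h0
  have hrestrict : μ.restrict E = μ := Measure.restrict_eq_self_of_ae_mem hnull
  refine ⟨μ, ⟨inferInstance, inferInstance⟩, hnull, fun b => ?_⟩
  rw [IntegrableOn, hrestrict]
  exact ⟨hintegrable b, heq b⟩

end Haviland

end CylinderMoment

theorem corollary10p3 {A : Type*} [CommRing A] [Algebra ℝ A]
    (hA : Algebra.FiniteType ℝ A)
    (S : Set A) (hS : CylinderMoment.IsSemiring S) (hSarch : CylinderMoment.IsArchimedean S)
    (J : Set ℝ) (hJclosed : IsClosed J) (hJunbdd : ¬ Bornology.IsBounded J)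
    (L : Polynomial A →ₗ[ℝ] ℝ)
    (hL : ∀ a ∈ CylinderMoment.tensorCone S (CylinderMoment.posPolynomials J), 0 ≤ L a) :
    CylinderMoment.IsMomentFunctional
      (CylinderMoment.cylinder (CylinderMoment.positiveCharacters S) J) L := by
  have hfin : Algebra.FiniteType ℝ (Polynomial A) := Algebra.FiniteType.trans hA inferInstance
  exact CylinderMoment.isMomentFunctional_of_nonneg hfin
    (CylinderMoment.isClosed_cylinder hJclosed) fun _ hb =>
      CylinderMoment.nonneg_of_nonneg_on_cylinder hS hSarch hL hb
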